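/- Conventions. A word is an element $w=w(x_1,\dots,x_n)$ of the free group $F(X)$ on $X=\{x_1,x_2,\dots\}$. For a group $G$, $w[G]=\{w(g_1,\dots,g_n) : g_1,\dots,g_n\in G\}$ is the set of values of $w$ in $G$, and $w(G)$ is the subgroup of $G$ generated by $w[G]$. The word $w$ is proper if there are groups $G$ and $H$ with $w[G]\neq\{1\}$ and $w[H]\neq H$. Let $e(w)$ be the greatest common divisor of the exponent sums in $w$ of the letters occurring in $w$ (with $e(w)=0$ if all of them are $0$); $w$ is a commutator word if $e(w)=0$. The rational subsets of a group $G$ form the smallest family of subsets of $G$ that contains all finite subsets and is closed under union, product $L_1L_2=\{ab : a\in L_1,\ b\in L_2\}$, and passing from $L$ to the submonoid $L^{*}$ generated by $L$. Statement. (1) Let $G=A*B$ be a free product of two nontrivial groups $A$ and $B$ that are not both of order $2$. If $w$ is a proper word such that $w(G)$ has infinite index in $G$, then $w[G]$ is not rational in $G$. (2) Let $G=A*B$ be a free product of two nontrivial groups whose abelianization $G_{ab}=G/[G,G]$ is infinite. Then for every nontrivial commutator word $w$ the set $w[G]$ is not rational in $G$. (3) Let $F$ be a free non-abelian group (of arbitrary,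 possibly infinite, rank). Then for every nontrivial commutator word $w$ the set $w[F]$ is not rational in $F$. -/

import Mathlib

open scoped Pointwise

universe uA uB uF uG uH

namespace Verbal

/-- The rational subsets of a monoid `M`: the smallest family of subsets of `M` that contains
all finite subsets and is closed under union, product and submonoid generation. -/
inductive IsRational {M : Type*} [Monoid M] : Set M → Prop
  | finite (L : Set M) : L.Finite → IsRational L
  | union (L₁ L₂ : Set M) : IsRational L₁ → IsRational L₂ → IsRational (L₁ ∪ L₂)
  | mul (L₁ L₂ : Set M) : IsRational L₁ → IsRational L₂ → IsRational (L₁ * L₂)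
  | star (L : Set M) : IsRational L → IsRational (Submonoid.closure L : Set M)

/-- Group words are the elements of the free group on countably many letters. -/
abbrev Word : Type := FreeGroup ℕ

/-- `w[G]`: the set of all values of the word `w` in the group `G`. -/
def values (w : Word) (G : Type*) [Group G] : Set G :=
  Set.range fun x : ℕ → G => FreeGroup.lift x w

/-- `w(G)`: the verbal subgroup, generated by the values of `w` in `G`. -/
def verbalSubgroup (w : Word) (G : Type*) [Group G] : Subgroup G :=
  Subgroup.closure (values w G)

/-- `w` is proper if `w[G] ≠ 1` for some group `G` and `w[H] ≠ H` for some group `H`. -/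
def IsProper (w : Word) : Prop :=
  (∃ (G : Type uG) (_ : Group G), values w G ≠ {1}) ∧
    ∃ (H : Type uH) (_ : Group H), values w H ≠ Set.univ

/-- The exponent sum of the letter `i` in `w`. -/
def exponentSum (w : Word) (i : ℕ) : ℤ :=
  (FreeGroup.lift (fun j : ℕ => Multiplicative.ofAdd (if j = i then (1 : ℤ) else 0)) w).toAdd

/-- `e(w)`: the greatest common divisor of the exponent sums of the letters that occur in `w`
(it is `0` if they all vanish). -/
def expGcd (w : Word) : ℕ :=
  (w.toWord.map Prod.fst).toFinset.gcd fun i => (exponentSum w i).natAbs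

/-- A commutator word is a word `w` with `e(w) = 0`. -/
def IsCommutatorWord (w : Word) : Prop := expGcd w = 0

end Verbal

/-! The argument plays two finiteness properties against each other. A rational subset of a group
generates a finitely generated subgroup (`IsRational.fg_closure`), so if `w[G]` were rational, the
normal subgroup `w(G)` would be finitely generated. But in a free product of two nontrivial groups,
not both of order 2, a nontrivial finitely generated normal subgroup has finite index
(`finiteIndex_of_fg_normal`). This is an ends argument: the set of elements whose reduced form
begins in a given factor changes only finitely under right multiplication, while a nontrivial normal
subgroup moves every point across it.

Nontriviality of `w(G)` holds because `G` contains a free group of infinite rank, where a nontrivial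
word takes a nontrivial value. This gives (1). For (2) and (3), a commutator word vanishes on every
commutative quotient, so an infinite one forces `w(G)` to have infinite index; a non-abelian free
group is a free product of infinite cyclic groups. -/

namespace Verbal

/-! ### Rational subsets generate finitely generated subgroups -/

section Rational

variable {G : Type*} [Group G]

/-- The subgroup generated by `L` is generated by the differences of elements of `L` together
with a single element of `L`. -/
theorem closure_eq_closure_mul_inv_sup {L : Set G} {a : G} (ha : a ∈ L) :
    Subgroup.closure L = Subgroup.closure (L * L⁻¹) ⊔ Subgroup.closure {a} := by
  apply le_antisymm
  · rw [Subgroup.closure_le]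
    intro x hx
    have h1 : x * a⁻¹ ∈ Subgroup.closure (L * L⁻¹) :=
      Subgroup.subset_closure (Set.mul_mem_mul hx (Set.inv_mem_inv.2 ha))
    have h2 : a ∈ Subgroup.closure {a} := Subgroup.subset_closure rfl
    simpa using Subgroup.mul_mem_sup h1 h2
  · rw [sup_le_iff, Subgroup.closure_le, Subgroup.closure_le]
    constructor
    · rintro _ ⟨x, hx, y, hy, rfl⟩
      refine mul_mem (Subgroup.subset_closure hx) ?_
      rw [← inv_inv y]
      exact inv_mem (Subgroup.subset_closure hy)
    · rintro _ rfl
      exact Subgroup.subset_closure ha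

theorem fg_closure_of_fg_closure_mul_inv {L : Set G}
    (h : (Subgroup.closure (L * L⁻¹)).FG) : (Subgroup.closure L).FG := by
  rcases L.eq_empty_or_nonempty with rfl | ⟨a, ha⟩
  · exact (Subgroup.fg_iff _).2 ⟨∅, rfl, Set.finite_empty⟩
  · rw [closure_eq_closure_mul_inv_sup ha]
    exact h.sup ((Subgroup.fg_iff _).2 ⟨{a}, rfl, Set.finite_singleton a⟩)

theorem closure_union_mul_inv {L₁ L₂ : Set G} {a b : G} (ha : a ∈ L₁) (hb : b ∈ L₂) :
    Subgroup.closure ((L₁ ∪ L₂) * (L₁ ∪ L₂)⁻¹) =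
      Subgroup.closure (L₁ * L₁⁻¹) ⊔ Subgroup.closure (L₂ * L₂⁻¹) ⊔
        Subgroup.closure {a * b⁻¹} := by
  set H := Subgroup.closure (L₁ * L₁⁻¹) ⊔ Subgroup.closure (L₂ * L₂⁻¹) ⊔
        Subgroup.closure {a * b⁻¹} with hH
  apply le_antisymm
  · have hab : a * b⁻¹ ∈ H := le_sup_right (a := Subgroup.closure (L₁ * L₁⁻¹) ⊔
      Subgroup.closure (L₂ * L₂⁻¹)) (Subgroup.subset_closure rfl)
    have h1 : ∀ x ∈ L₁, ∀ y ∈ L₁, x * y⁻¹ ∈ H := fun x hx y hy =>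
      (le_sup_left.trans le_sup_left : Subgroup.closure (L₁ * L₁⁻¹) ≤ H)
        (Subgroup.subset_closure (Set.mul_mem_mul hx (Set.inv_mem_inv.2 hy)))
    have h2 : ∀ x ∈ L₂, ∀ y ∈ L₂, x * y⁻¹ ∈ H := fun x hx y hy =>
      (le_sup_right.trans le_sup_left : Subgroup.closure (L₂ * L₂⁻¹) ≤ H)
        (Subgroup.subset_closure (Set.mul_mem_mul hx (Set.inv_mem_inv.2 hy)))
    have h12 : ∀ x ∈ L₁, ∀ y ∈ L₂, x * y⁻¹ ∈ H := fun x hx y hy => by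
      have := mul_mem (mul_mem (h1 x hx a ha) hab) (h2 b hb y hy)
      simpa [mul_assoc] using this
    rw [Subgroup.closure_le]
    rintro _ ⟨x, hx, y, hy, rfl⟩
    obtain ⟨y, rfl⟩ : ∃ z, y = z⁻¹ := ⟨y⁻¹, (inv_inv y).symm⟩
    rw [Set.inv_mem_inv] at hy
    rcases hx with hx | hx <;> rcases hy with hy | hy
    · exact h1 x hx y hy
    · exact h12 x hx y hy
    · have := inv_mem (h12 y hy x hx)
      simpa using this
    · exact h2 x hx y hy
  · rw [hH, sup_le_iff, sup_le_iff]
    refine ⟨⟨Subgroup.closure_mono ?_, Subgroup.closure_mono ?_⟩, Subgroup.closure_mono ?_⟩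
    · exact Set.mul_subset_mul Set.subset_union_left (Set.inv_subset_inv.2 Set.subset_union_left)
    · exact Set.mul_subset_mul Set.subset_union_right (Set.inv_subset_inv.2 Set.subset_union_right)
    · rintro _ rfl
      exact Set.mul_mem_mul (Or.inl ha) (Set.inv_mem_inv.2 (Or.inr hb))

/-- The identity behind it is `x y y'⁻¹ x'⁻¹ = (x a⁻¹) (a y y'⁻¹ a⁻¹) (a x'⁻¹)`. -/
theorem closure_mul_mul_inv {L₁ L₂ : Set G} {a b : G} (ha : a ∈ L₁) (hb : b ∈ L₂) :
    Subgroup.closure ((L₁ * L₂) * (L₁ * L₂)⁻¹) =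
      Subgroup.closure (L₁ * L₁⁻¹) ⊔
        (Subgroup.closure (L₂ * L₂⁻¹)).map (MulAut.conj a).toMonoidHom := by
  apply le_antisymm
  · rw [Subgroup.closure_le]
    rintro _ ⟨_, ⟨x, hx, y, hy, rfl⟩, z, hz, rfl⟩
    rw [Set.mem_inv] at hz
    obtain ⟨x', hx', y', hy', hz⟩ := hz
    have hz : z = y'⁻¹ * x'⁻¹ := by rw [← inv_inv z, ← hz, mul_inv_rev]
    have h1 : ∀ x ∈ L₁, ∀ y ∈ L₁, x * y⁻¹ ∈ Subgroup.closure (L₁ * L₁⁻¹) := fun x hx y hy =>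
      Subgroup.subset_closure (Set.mul_mem_mul hx (Set.inv_mem_inv.2 hy))
    have h2 : a * (y * y'⁻¹) * a⁻¹ ∈
        (Subgroup.closure (L₂ * L₂⁻¹)).map (MulAut.conj a).toMonoidHom :=
      ⟨y * y'⁻¹, Subgroup.subset_closure (Set.mul_mem_mul hy (Set.inv_mem_inv.2 hy')), rfl⟩
    have := mul_mem (Subgroup.mul_mem_sup (h1 x hx a ha) h2)
      (Subgroup.mem_sup_left (h1 a ha x' hx'))
    subst hz
    simpa [mul_assoc] using this
  · rw [sup_le_iff, Subgroup.map_le_iff_le_comap, Subgroup.closure_le, Subgroup.closure_le]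
    constructor
    · rintro _ ⟨x, hx, y, hy, rfl⟩
      refine Subgroup.subset_closure ⟨x * b, Set.mul_mem_mul hx hb, b⁻¹ * y, ?_, by simp [mul_assoc]⟩
      rw [Set.mem_inv, mul_inv_rev, inv_inv]
      exact Set.mul_mem_mul hy hb
    · rintro _ ⟨x, hx, y, hy, rfl⟩
      refine Subgroup.subset_closure ⟨a * x, Set.mul_mem_mul ha hx, y * a⁻¹, ?_, by simp [mul_assoc]⟩
      rw [Set.mem_inv, mul_inv_rev, inv_inv]
      exact Set.mul_mem_mul ha hy

theorem fg_map {H : Type*} [Group H] {N : Subgroup G} (hN : N.FG) (f : G →* H) :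
    (N.map f).FG := by
  obtain ⟨S, rfl, hS⟩ := (Subgroup.fg_iff _).1 hN
  exact (Subgroup.fg_iff _).2 ⟨f '' S, (f.map_closure S).symm, hS.image f⟩

/-- Differences `L * L⁻¹` are used instead of `L` because their closure behaves well under products:
only a conjugation by one fixed element appears. -/
theorem IsRational.fg_closure_mul_inv {L : Set G} (hL : IsRational L) :
    (Subgroup.closure (L * L⁻¹)).FG := by
  induction hL with
  | finite L h => exact (Subgroup.fg_iff _).2 ⟨_, rfl, h.mul h.inv⟩
  | union L₁ L₂ _ _ h₁ h₂ =>
    rcases L₁.eq_empty_or_nonempty with rfl | ⟨a, ha⟩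
    · simpa using h₂
    rcases L₂.eq_empty_or_nonempty with rfl | ⟨b, hb⟩
    · simpa using h₁
    rw [closure_union_mul_inv ha hb]
    exact (h₁.sup h₂).sup ((Subgroup.fg_iff _).2 ⟨_, rfl, Set.finite_singleton _⟩)
  | mul L₁ L₂ _ _ h₁ h₂ =>
    rcases L₁.eq_empty_or_nonempty with rfl | ⟨a, ha⟩
    · exact (Subgroup.fg_iff _).2 ⟨∅, by simp, Set.finite_empty⟩
    rcases L₂.eq_empty_or_nonempty with rfl | ⟨b, hb⟩
    · exact (Subgroup.fg_iff _).2 ⟨∅, by simp, Set.finite_empty⟩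
    rw [closure_mul_mul_inv ha hb]
    exact h₁.sup (fg_map h₂ _)
  | star L _ h =>
    have key : Subgroup.closure ((Submonoid.closure L : Set G) * (Submonoid.closure L : Set G)⁻¹) =
        Subgroup.closure L := by
      apply le_antisymm
      · have hle : ∀ x ∈ Submonoid.closure L, x ∈ Subgroup.closure L := fun x hx =>
          (Submonoid.closure_le (S := (Subgroup.closure L).toSubmonoid)).2
            Subgroup.subset_closure hx
        rw [Subgroup.closure_le]
        rintro _ ⟨x, hx, y, hy, rfl⟩
        refine mul_mem (hle x hx) ?_
        rw [← inv_inv y]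
        exact inv_mem (hle _ hy)
      · refine Subgroup.closure_mono fun x hx => ⟨x, Submonoid.subset_closure hx, 1, ?_, mul_one x⟩
        rw [Set.mem_inv, inv_one]
        exact one_mem _
    rw [key]
    exact fg_closure_of_fg_closure_mul_inv h

/-- A rational subset of a group generates a finitely generated subgroup. -/
theorem IsRational.fg_closure {L : Set G} (hL : IsRational L) : (Subgroup.closure L).FG :=
  fg_closure_of_fg_closure_mul_inv hL.fg_closure_mul_inv

end Rational

open Monoid

/-! ### Free products -/

section FreeProduct

variable {ι : Type*} {M : ι → Type*} [∀ i, Group (M i)]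

open scoped Classical in
/-- The elements of a free product whose reduced form begins with a letter from `M i`. -/
def startsIn (M : ι → Type*) [∀ i, Group (M i)] (i : ι) : Set (CoprodI M) :=
  {g | (CoprodI.Word.equiv g).fstIdx = some i}

theorem prod_mem_startsIn {i : ι} {w : CoprodI.Word M} :
    w.prod ∈ startsIn M i ↔ w.fstIdx = some i := by
  classical
  have : CoprodI.Word.equiv w.prod = w := CoprodI.Word.equiv.apply_symm_apply w
  rw [startsIn, Set.mem_ofPred_eq]
  convert Iff.rfl using 3
  convert this.symm

theorem exists_prod_eq (g : CoprodI M) : ∃ w : CoprodI.Word M, w.prod = g := by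
  classical
  exact ⟨CoprodI.Word.equiv g, CoprodI.Word.equiv.symm_apply_apply g⟩

theorem one_notMem_startsIn (i : ι) : (1 : CoprodI M) ∉ startsIn M i := by
  rw [← CoprodI.Word.prod_empty, prod_mem_startsIn]
  simp [CoprodI.Word.fstIdx, CoprodI.Word.empty]

theorem startsIn_unique {i j : ι} {g : CoprodI M} (hi : g ∈ startsIn M i)
    (hj : g ∈ startsIn M j) : i = j :=
  Option.some_injective _ (hi.symm.trans hj)

theorem of_mul_mem_startsIn {i : ι} {m : M i} (hm : m ≠ 1) {g : CoprodI M}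
    (hg : g ∉ startsIn M i) : CoprodI.of m * g ∈ startsIn M i := by
  obtain ⟨w, rfl⟩ := exists_prod_eq g
  rw [prod_mem_startsIn] at hg
  rw [← CoprodI.Word.prod_cons i m w hm hg, prod_mem_startsIn, CoprodI.Word.fstIdx_cons]

theorem of_mem_startsIn {i : ι} {m : M i} (hm : m ≠ 1) : CoprodI.of m ∈ startsIn M i := by
  simpa using of_mul_mem_startsIn hm (one_notMem_startsIn i)

/-- Induction on the length of the reduced form. -/
theorem reduced_induction {P : CoprodI M → Prop} (one : P 1)
    (mul : ∀ (i : ι) (m : M i) (g : CoprodI M), m ≠ 1 → g ∉ startsIn M i → P g →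
      P (CoprodI.of m * g)) (g : CoprodI M) : P g := by
  obtain ⟨w, rfl⟩ := exists_prod_eq g
  induction w using CoprodI.Word.consRecOn with
  | empty => simpa using one
  | cons i m w h1 h2 ih =>
    rw [CoprodI.Word.prod_cons]
    exact mul i m _ h2 (mt prod_mem_startsIn.1 h1) ih

/-- Right multiplication by a letter `x` keeps the first syllable, unless a word consisting of a
single letter is cancelled. -/
theorem mul_of_mem_startsIn {k : ι} (x : M k) (g : CoprodI M) : ∀ l, g ∈ startsIn M l →
    g * CoprodI.of x ∈ startsIn M l ∨ l = k ∧ g * CoprodI.of x = 1 := by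
  induction g using reduced_induction with
  | one => exact fun l h => absurd h (one_notMem_startsIn l)
  | mul i m g hm hg ih =>
    intro l hl
    obtain rfl := startsIn_unique hl (of_mul_mem_startsIn hm hg)
    rw [mul_assoc]
    by_cases hgx : g * CoprodI.of x ∈ startsIn M l
    · obtain ⟨w, rfl⟩ := exists_prod_eq g
      rcases hw : w.fstIdx with _ | l'
      · have hw1 : w.prod = 1 := by
          have : w.toList = [] := by simpa [CoprodI.Word.fstIdx] using hw
          simp [CoprodI.Word.prod, this]
        rw [hw1, one_mul] at hgx ⊢
        have hx : x ≠ 1 := by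
          rintro rfl
          rw [map_one] at hgx
          exact one_notMem_startsIn _ hgx
        obtain rfl := startsIn_unique hgx (of_mem_startsIn hx)
        rw [← map_mul]
        by_cases hmx : m * x = 1
        · exact Or.inr ⟨rfl, by rw [hmx, map_one]⟩
        · exact Or.inl (of_mem_startsIn hmx)
      · have hl' := prod_mem_startsIn.2 hw
        rcases ih l' hl' with h | ⟨-, h⟩
        · obtain rfl := startsIn_unique h hgx
          exact absurd hl' hg
        · rw [h] at hgx
          exact absurd hgx (one_notMem_startsIn _)
    · exact Or.inl (of_mul_mem_startsIn hm hgx)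

/-- `startsIn M i` is almost invariant under right multiplication. -/
theorem finite_setOf_startsIn_mul (i : ι) (x : CoprodI M) :
    {g | ¬ (g ∈ startsIn M i ↔ g * x ∈ startsIn M i)}.Finite := by
  induction x using CoprodI.induction_on with
  | one => simp
  | of k x =>
    -- A letter can affect the first syllable only by creating it from `1` or by cancelling the
    -- one-letter word `x⁻¹`.
    refine (Set.toFinite {1, (CoprodI.of x)⁻¹}).subset fun g hg => ?_
    simp only [Set.mem_ofPred_eq] at hg
    by_cases h : g ∈ startsIn M i
    · rcases mul_of_mem_startsIn x g i h with h' | ⟨-, h'⟩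
      · exact absurd (iff_of_true h h') hg
      · exact Or.inr (eq_inv_of_mul_eq_one_left h')
    · by_cases h2 : g * CoprodI.of x ∈ startsIn M i
      · rcases mul_of_mem_startsIn x⁻¹ _ i h2 with h' | ⟨-, h'⟩
        · exact absurd (by simpa using h') h
        · exact Or.inl (by simpa using h')
      · exact absurd (iff_of_false h h2) hg
  | mul x y hx hy =>
    refine (hx.union (hy.preimage (mul_left_injective x).injOn)).subset fun g hg => ?_
    simp only [Set.mem_ofPred_eq, Set.mem_union, Set.mem_preimage, ← mul_assoc] at hg ⊢
    tauto

/-- A finitely generated normal subgroup of a free product has finite index if none of its orbits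
is separated from the base point by `startsIn M i`. -/
theorem finiteIndex_of_orbits (N : Subgroup (CoprodI M)) [hN : N.Normal] (hfg : N.FG) (i : ι)
    (h : ∀ x, ∃ n ∈ N, ¬ (x ∈ startsIn M i ↔ n * x ∈ startsIn M i)) : N.FiniteIndex := by
  obtain ⟨S, hS, hSfin⟩ := (Subgroup.fg_iff _).1 hfg
  set K : Set (CoprodI M) :=
    ⋃ s ∈ S, {g | ¬ (g ∈ startsIn M i ↔ g * s ∈ startsIn M i)}⁻¹ with hK
  have hKfin : K.Finite := hSfin.biUnion fun s _ => (finite_setOf_startsIn_mul i s).inv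
  -- A path from `g⁻¹` to `g⁻¹ * n` with steps in `S` and their inverses must cross the boundary of
  -- `startsIn M i` along some edge; the finitely many possible edges show that `g ∈ N * K`.
  have key : ∀ n ∈ Subgroup.closure S, ∀ g : CoprodI M,
      ¬ (g⁻¹ ∈ startsIn M i ↔ g⁻¹ * n ∈ startsIn M i) → ∃ a ∈ N, ∃ k ∈ K, g = a * k := by
    intro n hn
    induction hn using Subgroup.closure_induction with
    | mem s hs =>
      exact fun g hg => ⟨1, one_mem _, g, Set.mem_biUnion hs hg, (one_mul g).symm⟩
    | one => simp
    | mul x y hx hy ihx ihy =>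
      intro g hg
      by_cases h1 : g⁻¹ ∈ startsIn M i ↔ g⁻¹ * x ∈ startsIn M i
      · obtain ⟨a, ha, k, hk, e⟩ := ihy (x⁻¹ * g) (by
          rw [mul_inv_rev, inv_inv, ← h1, mul_assoc]
          exact hg)
        exact ⟨x * a, mul_mem (hS ▸ hx) ha, k, hk, by rw [mul_assoc, ← e, mul_inv_cancel_left]⟩
      · exact ihx g h1
    | inv x hx ihx =>
      intro g hg
      obtain ⟨a, ha, k, hk, e⟩ := ihx (x * g) (by
        rw [mul_inv_rev, inv_mul_cancel_right]
        exact fun h => hg h.symm)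
      exact ⟨x⁻¹ * a, mul_mem (inv_mem (hS ▸ hx)) ha, k, hk, by
        rw [mul_assoc, ← e, inv_mul_cancel_left]⟩
  have hfin : Finite (CoprodI M ⧸ N) := by
    have : Finite K := hKfin
    refine Finite.of_surjective (fun k : K => (QuotientGroup.mk k.1 : CoprodI M ⧸ N)) fun q => ?_
    obtain ⟨g, rfl⟩ := QuotientGroup.mk_surjective q
    obtain ⟨n, hn, hx⟩ := h g⁻¹
    -- Normality turns the left translate `n * g⁻¹` into the right translate `g⁻¹ * (g * n * g⁻¹)`.
    obtain ⟨a, ha, k, hk, rfl⟩ := key (g * n * g⁻¹) (hS ▸ hN.conj_mem n hn g) g (by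
      simpa [mul_assoc] using hx)
    refine ⟨⟨k, hk⟩, ?_⟩
    rw [QuotientGroup.mk_mul, (QuotientGroup.eq_one_iff a).2 ha, one_mul]
  exact Subgroup.finiteIndex_of_finite_quotient

/-- `g` is a nonempty reduced word beginning in `M i` and ending in `M j`, expressed through
ping-pong. -/
def PingPong (i j : ι) (g : CoprodI M) : Prop :=
  (∀ x ∉ startsIn M j, g * x ∈ startsIn M i) ∧ ∀ x ∉ startsIn M i, g⁻¹ * x ∈ startsIn M j

theorem PingPong.inv {i j : ι} {g : CoprodI M} (h : PingPong i j g) : PingPong j i g⁻¹ :=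
  ⟨h.2, by simpa using h.1⟩

theorem PingPong.mul {i j k l : ι} {g g' : CoprodI M} (h : PingPong i j g) (h' : PingPong k l g')
    (hjk : j ≠ k) : PingPong i l (g * g') := by
  constructor
  · intro x hx
    rw [mul_assoc]
    exact h.1 _ fun hh => hjk (startsIn_unique hh (h'.1 x hx))
  · intro x hx
    rw [mul_inv_rev, mul_assoc]
    exact h'.2 _ fun hh => hjk (startsIn_unique (h.2 x hx) hh)

theorem pingPong_of {i : ι} {m : M i} (hm : m ≠ 1) : PingPong i i (CoprodI.of m) :=
  ⟨fun _ hx => of_mul_mem_startsIn hm hx, fun _ hx => by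
    rw [← map_inv]
    exact of_mul_mem_startsIn (inv_ne_one.2 hm) hx⟩

theorem PingPong.mem_startsIn {i j : ι} {g : CoprodI M} (h : PingPong i j g) :
    g ∈ startsIn M i := by
  simpa using h.1 1 (one_notMem_startsIn j)

/-- The shape of nontrivial elements: a single letter, or a letter followed by a shorter word. -/
theorem exists_eq_of_or_of_mul {g : CoprodI M} (hg : g ≠ 1) : ∃ (i : ι) (m : M i), m ≠ 1 ∧
    (g = CoprodI.of m ∨ ∃ (p q : ι) (g' : CoprodI M), i ≠ p ∧ PingPong p q g' ∧
      g = CoprodI.of m * g') := by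
  induction g using reduced_induction with
  | one => exact absurd rfl hg
  | mul i m g hm hgi ih =>
    refine ⟨i, m, hm, ?_⟩
    by_cases h1 : g = 1
    · exact Or.inl (by rw [h1, mul_one])
    · obtain ⟨p, m', hm', h⟩ := ih h1
      obtain ⟨q, hq⟩ : ∃ q, PingPong p q g := by
        rcases h with rfl | ⟨p', q, g', hne, hg', rfl⟩
        · exact ⟨p, pingPong_of hm'⟩
        · exact ⟨q, (pingPong_of hm').mul hg' hne⟩
      refine Or.inr ⟨p, q, g, ?_, hq, rfl⟩
      rintro rfl
      exact hgi hq.mem_startsIn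

theorem exists_pingPong {g : CoprodI M} (hg : g ≠ 1) : ∃ i j, PingPong i j g := by
  obtain ⟨i, m, hm, rfl | ⟨p, q, g', hne, hg', rfl⟩⟩ := exists_eq_of_or_of_mul hg
  · exact ⟨i, i, pingPong_of hm⟩
  · exact ⟨i, q, (pingPong_of hm).mul hg' hne⟩

/-- A nontrivial normal subgroup contains an element beginning and ending in `M i`, if `M i` has
more than two elements. -/
theorem exists_mem_pingPong_self (N : Subgroup (CoprodI M)) [hN : N.Normal] (hbot : N ≠ ⊥) {i : ι}
    {a a' : M i} (ha : a ≠ 1) (ha' : a' ≠ 1) (haa' : a ≠ a') : ∃ n ∈ N, PingPong i i n := by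
  have fromLeft : ∀ n ∈ N, ∀ q ≠ i, PingPong i q n → ∃ n ∈ N, PingPong i i n := by
    intro n hn q hq h
    obtain ⟨p, m, hm, hshape⟩ := exists_eq_of_or_of_mul (g := n) (by
      rintro rfl
      exact one_notMem_startsIn _ h.mem_startsIn)
    -- One of `a`, `a'` differs from the first letter `m`; conjugating by its inverse alters `m` to
    -- `c⁻¹ * m ≠ 1` without cancelling it and appends `c` at the end.
    obtain ⟨c, hc, hcm⟩ : ∃ c : M i, c ≠ 1 ∧ ∀ e : p = i, e ▸ m ≠ c := by
      by_cases e : ∃ e : p = i, e ▸ m = a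
      · obtain ⟨e, he⟩ := e
        exact ⟨a', ha', fun _ h => haa' (he.symm.trans h)⟩
      · exact ⟨a, ha, fun e' h => e ⟨e', h⟩⟩
    have hconj := hN.conj_mem n hn (CoprodI.of c⁻¹)
    refine ⟨_, hconj, ?_⟩
    rcases hshape with rfl | ⟨p', q', g', hne, hg', rfl⟩
    · have h1 := (pingPong_of hm).mem_startsIn
      obtain rfl := startsIn_unique h1 h.mem_startsIn
      have := h.inv.mem_startsIn
      exact absurd (startsIn_unique this (pingPong_of hm).inv.mem_startsIn) hq
    · obtain rfl := startsIn_unique ((pingPong_of hm).mul hg' hne).mem_startsIn h.mem_startsIn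
      obtain rfl := startsIn_unique ((pingPong_of hm).mul hg' hne).inv.mem_startsIn
        h.inv.mem_startsIn
      have hcm' : c⁻¹ * m ≠ 1 := fun e => hcm rfl (inv_mul_eq_one.1 e).symm
      have := ((pingPong_of hcm').mul hg' hne).mul (pingPong_of hc) hq
      simpa [mul_assoc] using this
  obtain ⟨n, hn, hn1⟩ := N.bot_or_exists_ne_one.resolve_left hbot
  obtain ⟨p, q, hpq⟩ := exists_pingPong hn1
  by_cases hp : p = i
  · subst hp
    by_cases hq : q = p
    · exact hq ▸ ⟨n, hn, hq ▸ hpq⟩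
    · exact fromLeft n hn q hq hpq
  · by_cases hq : q = i
    · subst hq
      exact fromLeft n⁻¹ (inv_mem hn) p hp hpq.inv
    · refine ⟨_, hN.conj_mem n hn (CoprodI.of a), ?_⟩
      exact ((pingPong_of ha).mul hpq (Ne.symm hp)).mul (pingPong_of ha).inv hq

/-- A nontrivial finitely generated normal subgroup of a free product has finite index (for a free
product of two nontrivial groups, one of which has more than two elements). -/
theorem finiteIndex_of_fg_normal (N : Subgroup (CoprodI M)) [hN : N.Normal] (hfg : N.FG)
    (hbot : N ≠ ⊥) {i j : ι} (hij : i ≠ j) {a a' : M i} (ha : a ≠ 1) (ha' : a' ≠ 1)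
    (haa' : a ≠ a') {b : M j} (hb : b ≠ 1) : N.FiniteIndex := by
  obtain ⟨m, hm, hmi⟩ := exists_mem_pingPong_self N hbot ha ha' haa'
  have hconj := hN.conj_mem m hm (CoprodI.of b)
  have hj : PingPong j j (CoprodI.of b * m * (CoprodI.of b)⁻¹) :=
    ((pingPong_of hb).mul hmi hij.symm).mul (pingPong_of hb).inv hij
  -- `m` pushes points into `startsIn M i`, and its conjugate by `b` pushes them out, into `startsIn
  -- M j`.
  refine finiteIndex_of_orbits N hfg i fun x => ?_
  by_cases hx : x ∈ startsIn M i
  · refine ⟨_, hconj, fun h => hij (startsIn_unique (h.1 hx) (hj.1 x ?_))⟩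
    exact fun hx' => hij (startsIn_unique hx hx')
  · exact ⟨m, hm, fun h => hx (h.2 (hmi.1 x hx))⟩

/-- The free product of two nontrivial groups, one of which has more than two elements, contains
a free group of infinite rank. -/
theorem exists_freeGroup_injective {i j : ι} (hij : i ≠ j) {a a' : M i} (ha : a ≠ 1) (ha' : a' ≠ 1)
    (haa' : a ≠ a') {b : M j} (hb : b ≠ 1) :
    ∃ t : ℕ → CoprodI M, Function.Injective (FreeGroup.lift t) := by
  set c : CoprodI M := CoprodI.of b * CoprodI.of a
  set d : CoprodI M := CoprodI.of b * CoprodI.of a'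
  set U := startsIn M j
  have hc : PingPong j i c := (pingPong_of hb).mul (pingPong_of ha) hij.symm
  have hd : PingPong j i d := (pingPong_of hb).mul (pingPong_of ha') hij.symm
  have hUi : ∀ x ∈ U, x ∉ startsIn M i := fun x hx hx' => hij (startsIn_unique hx' hx)
  have hcd : ∀ x ∈ U, ∀ y ∈ U, c * x ≠ d * y := by
    intro x hx y hy e
    have e' : x = CoprodI.of (a⁻¹ * a') * y := by
      have : CoprodI.of a * x = CoprodI.of a' * y := by
        simpa only [c, d, mul_assoc, mul_right_inj] using e
      rw [map_mul, mul_assoc, ← this, map_inv, inv_mul_cancel_left]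
    have := of_mul_mem_startsIn (m := a⁻¹ * a') (fun h => haa' (inv_mul_eq_one.1 h)) (hUi y hy)
    rw [← e'] at this
    exact hUi x hx this
  have hcU : ∀ (n : ℕ), ∀ x ∈ U, c ^ n * x ∈ U := by
    intro n
    induction n with
    | zero => simp
    | succ n ih =>
      intro x hx
      rw [pow_succ', mul_assoc]
      exact hc.1 _ (hUi _ (ih x hx))
  -- These are the translates `c ^ n * d * U`, pairwise disjoint because `c * U` and `d * U` are
  -- disjoint subsets of `U`.
  set Z : ℕ → Set (CoprodI M) := fun n => {x | (c ^ n * d)⁻¹ * x ∈ U}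
  have hZlt : ∀ m n : ℕ, m < n → Disjoint (Z m) (Z n) := by
    intro m n hmn
    rw [Set.disjoint_left]
    intro x hm hn
    obtain ⟨k, rfl⟩ := Nat.exists_eq_add_of_lt hmn
    refine hcd (c ^ k * (d * ((c ^ (m + k + 1) * d)⁻¹ * x))) (hcU _ _ (hd.1 _ (hUi _ hn))) _ hm ?_
    simp only [mul_inv_rev, mul_assoc, mul_inv_cancel_left]
    rw [← mul_assoc c, ← pow_succ', show m + k + 1 = m + (k + 1) from add_assoc _ _ _, pow_add c m (k + 1),
      mul_inv_rev]
    simp [mul_assoc]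
  have hZ : ∀ m n : ℕ, m ≠ n → Disjoint (Z m) (Z n) := fun m n h =>
    (lt_or_gt_of_ne h).elim (hZlt m n) fun h => (hZlt n m h).symm
  have hZne : ∀ n, (Z n).Nonempty := fun n =>
    ⟨c ^ n * d * CoprodI.of b, by simpa [Z, U, mul_assoc] using of_mem_startsIn hb⟩
  -- The factors of `s k` carry the complement of `Z (2 * k + 1)` first to the complement of `U`,
  -- then by `b` into `U`, then into `Z (2 * k)`.
  set s : ℕ → CoprodI M := fun k =>
    c ^ (2 * k) * d * CoprodI.of b * (c ^ (2 * k + 1) * d)⁻¹ with hs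
  have hinj := FreeGroup.injective_lift_of_ping_pong (α := CoprodI M)
    (fun k : ULift ℕ => s k.down) (fun k => Z (2 * k.down)) (fun k => Z (2 * k.down + 1))
    (fun k => hZne _) (fun k l h => hZ _ _ fun e => h (ULift.ext _ _ (by omega)))
    (fun k l h => hZ _ _ fun e => h (ULift.ext _ _ (by omega)))
    (fun k l => hZ _ _ (by omega))
    (by
      rintro k _ ⟨x, hx, rfl⟩
      have := (pingPong_of hb).1 _ hx
      simpa [Z, s, mul_assoc] using this)
    (by
      rintro k _ ⟨x, hx, rfl⟩
      have := (pingPong_of hb).2 _ hx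
      simpa [Z, s, mul_assoc] using this)
  refine ⟨s, ?_⟩
  have hcomp : FreeGroup.lift s = (FreeGroup.lift fun k : ULift ℕ => s k.down).comp
      (FreeGroup.freeGroupCongr Equiv.ulift.symm).toMonoidHom := by
    ext n
    simp
  rw [hcomp]
  exact hinj.comp (MulEquiv.injective _)

end FreeProduct

/-! ### Verbal subgroups -/

section VerbalSubgroup

variable {G : Type*} [Group G]

theorem map_lift_word {H : Type*} [Group H] (f : G →* H) (x : ℕ → G) (w : Word) :
    f (FreeGroup.lift x w) = FreeGroup.lift (fun i => f (x i)) w := by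
  have : f.comp (FreeGroup.lift x) = FreeGroup.lift fun i => f (x i) := by
    ext i
    simp
  exact DFunLike.congr_fun this w

instance verbalSubgroup_normal (w : Word) : (verbalSubgroup w G).Normal := by
  refine ⟨fun n hn g => ?_⟩
  suffices verbalSubgroup w G ≤ (verbalSubgroup w G).comap (MulAut.conj g).toMonoidHom from this hn
  rw [verbalSubgroup, Subgroup.closure_le]
  rintro _ ⟨x, rfl⟩
  exact Subgroup.subset_closure ⟨_, (map_lift_word (MulAut.conj g).toMonoidHom x w).symm⟩

/-- In a free product of groups, two of them nontrivial and one of these of order at least three,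
the set of values of a nontrivial word that generates a subgroup of infinite index is not
rational. -/
theorem not_isRational_values {ι : Type*} {M : ι → Type*} [∀ i, Group (M i)]
    (e : G ≃* CoprodI M) {i j : ι} (hij : i ≠ j) {a a' : M i} (ha : a ≠ 1) (ha' : a' ≠ 1)
    (haa' : a ≠ a') {b : M j} (hb : b ≠ 1) {w : Word} (hw : w ≠ 1)
    (hindex : ¬ (verbalSubgroup w G).FiniteIndex) : ¬ IsRational (values w G) := by
  intro hrat
  set N := (verbalSubgroup w G).map e.toMonoidHom with hNdef
  have hN : N.Normal := (verbalSubgroup_normal w).map _ e.surjective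
  have hNfg : N.FG := fg_map hrat.fg_closure _
  have hbot : N ≠ ⊥ := by
    obtain ⟨t, ht⟩ := exists_freeGroup_injective hij ha ha' haa' hb
    have hval : FreeGroup.lift (fun k => e.symm (t k)) w ∈ verbalSubgroup w G :=
      Subgroup.subset_closure ⟨_, rfl⟩
    have hmem : FreeGroup.lift t w ∈ N :=
      ⟨_, hval, by rw [map_lift_word]; simp⟩
    intro h
    rw [h, Subgroup.mem_bot, ← map_one (FreeGroup.lift t)] at hmem
    exact hw (ht hmem)
  have hfin := finiteIndex_of_fg_normal N hNfg hbot hij ha ha' haa' hb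
  refine hindex ⟨?_⟩
  have hidx : N.index = (verbalSubgroup w G).index := Subgroup.index_map_equiv _ e
  rw [← hidx]
  exact hfin.index_ne_zero

/-- The exponent sum of a letter that does not occur vanishes. -/
theorem exponentSum_eq_zero_of_notMem {w : Word} {i : ℕ} (h : i ∉ w.toWord.map Prod.fst) :
    exponentSum w i = 0 := by
  rw [exponentSum, toAdd_eq_zero, ← FreeGroup.mk_toWord (x := w), FreeGroup.lift_mk]
  refine List.prod_eq_one fun x hx => ?_
  obtain ⟨p, hp, rfl⟩ := List.mem_map.1 hx
  have hne : p.1 ≠ i := fun e => h (List.mem_map.2 ⟨p, hp, e⟩)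
  cases p.2 <;> simp [hne]

theorem IsCommutatorWord.exponentSum_eq_zero {w : Word} (hw : IsCommutatorWord w) (i : ℕ) :
    exponentSum w i = 0 := by
  by_cases h : i ∈ w.toWord.map Prod.fst
  · exact Int.natAbs_eq_zero.1 (Finset.gcd_eq_zero_iff.1 hw i (List.mem_toFinset.2 h))
  · exact exponentSum_eq_zero_of_notMem h

/-- Commutator words vanish on commutative groups. -/
theorem IsCommutatorWord.lift_eq_one {w : Word} (hw : IsCommutatorWord w) {H : Type*} [CommGroup H]
    (x : ℕ → H) : FreeGroup.lift x w = 1 := by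
  -- `lift x` factors through the free abelian group, where the coordinates of `w` are its exponent
  -- sums.
  let E : FreeGroup ℕ →* Multiplicative (ℕ →₀ ℤ) :=
    FreeGroup.lift fun i => Multiplicative.ofAdd (Finsupp.single i 1)
  let Ψ : Multiplicative (ℕ →₀ ℤ) →* H := AddMonoidHom.toMultiplicativeLeft
    (Finsupp.liftAddHom fun i => zmultiplesHom (Additive H) (Additive.ofMul (x i)))
  have hΨ : FreeGroup.lift x = Ψ.comp E := by
    ext i
    simp [E, Ψ]
  have hE : E w = 1 := by
    apply Multiplicative.toAdd.injective
    ext i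
    let ev : Multiplicative (ℕ →₀ ℤ) →* Multiplicative ℤ :=
      AddMonoidHom.toMultiplicative (Finsupp.applyAddHom i)
    have hev : ev.comp E =
        FreeGroup.lift fun j : ℕ => Multiplicative.ofAdd (if j = i then (1 : ℤ) else 0) := by
      ext j
      simp [E, ev, Finsupp.single_apply]
    exact (congrArg Multiplicative.toAdd (DFunLike.congr_fun hev w)).trans
      (hw.exponentSum_eq_zero i)
  rw [hΨ, MonoidHom.comp_apply, hE, map_one]

/-- The verbal subgroup of a commutator word has infinite index in a group with an infinite
commutative image. -/
theorem IsCommutatorWord.not_finiteIndex {w : Word} (hw : IsCommutatorWord w) {H : Type*}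
    [CommGroup H] [Infinite H] (f : G →* H) (hf : Function.Surjective f) :
    ¬ (verbalSubgroup w G).FiniteIndex := by
  intro h
  have hle : verbalSubgroup w G ≤ f.ker := by
    rw [verbalSubgroup, Subgroup.closure_le]
    rintro _ ⟨x, rfl⟩
    rw [SetLike.mem_coe, MonoidHom.mem_ker, map_lift_word, hw.lift_eq_one]
  have hker : f.ker.FiniteIndex := Subgroup.finiteIndex_of_le hle
  have : Finite H := Finite.of_equiv _ (QuotientGroup.quotientKerEquivOfSurjective f hf).toEquiv
  exact not_finite H

end VerbalSubgroup

/-! ### Binary free products and free groups -/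

section Coprod

/-- The two factors of a binary free product, as a family indexed by `Bool`. -/
def Factor (A : Type uA) (B : Type uB) : Bool → Type (max uA uB)
  | true => ULift.{uB} A
  | false => ULift.{uA} B

variable {A : Type uA} {B : Type uB} [Group A] [Group B]

instance Factor.group : ∀ i, Group (Factor A B i)
  | true => inferInstanceAs (Group (ULift.{uB} A))
  | false => inferInstanceAs (Group (ULift.{uA} B))

/-- The embedding of the left factor. -/
def Factor.left : A ≃* Factor A B true := (MulEquiv.ulift : ULift.{uB} A ≃* A).symm

/-- The embedding of the right factor. -/
def Factor.right : B ≃* Factor A B false := (MulEquiv.ulift : ULift.{uA} B ≃* B).symm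

/-- A binary free product as a free product of a family. -/
def coprodEquivCoprodI : Coprod A B ≃* CoprodI (Factor A B) :=
  MonoidHom.toMulEquiv
    (Coprod.lift (CoprodI.of.comp (Factor.left (A := A) (B := B)).toMonoidHom)
      (CoprodI.of.comp (Factor.right (A := A) (B := B)).toMonoidHom))
    (CoprodI.lift fun i => match i with
      | true => Coprod.inl.comp (Factor.left (A := A) (B := B)).symm.toMonoidHom
      | false => Coprod.inr.comp (Factor.right (A := A) (B := B)).symm.toMonoidHom)
    (by ext <;> simp)
    (by
      ext i x
      cases i <;> simp)

theorem exists_pair_ne_one_of_card_ne_two [Nontrivial A] (h : Nat.card A ≠ 2) :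
    ∃ a a' : A, a ≠ 1 ∧ a' ≠ 1 ∧ a ≠ a' := by
  obtain ⟨a, ha⟩ := exists_ne (1 : A)
  by_contra! hcon
  refine h (Nat.card_eq_two_iff.2 ⟨1, a, ha.symm, ?_⟩)
  ext x
  simp only [Set.mem_insert_iff, Set.mem_singleton_iff, Set.mem_univ, iff_true]
  by_cases hx : x = 1
  · exact Or.inl hx
  · exact Or.inr (hcon a x ha hx).symm

theorem not_isRational_values_coprod [Nontrivial A] [Nontrivial B] {w : Word}
    (hcard : ¬ (Nat.card A = 2 ∧ Nat.card B = 2)) (hw : w ≠ 1)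
    (hindex : ¬ (verbalSubgroup w (Coprod A B)).FiniteIndex) :
    ¬ IsRational (values w (Coprod A B)) := by
  by_cases hA : Nat.card A = 2
  · obtain ⟨b, b', hb, hb', hbb'⟩ := exists_pair_ne_one_of_card_ne_two fun hB => hcard ⟨hA, hB⟩
    obtain ⟨a, ha⟩ := exists_ne (1 : A)
    exact not_isRational_values coprodEquivCoprodI Bool.false_ne_true
      (a := Factor.right b) (a' := Factor.right b') (b := Factor.left a)
      (by simpa using hb) (by simpa using hb') (by simpa using hbb') (by simpa using ha) hw hindex
  · obtain ⟨a, a', ha, ha', haa'⟩ := exists_pair_ne_one_of_card_ne_two hA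
    obtain ⟨b, hb⟩ := exists_ne (1 : B)
    exact not_isRational_values coprodEquivCoprodI Bool.false_ne_true.symm
      (a := Factor.left a) (a' := Factor.left a') (b := Factor.right b)
      (by simpa using ha) (by simpa using ha') (by simpa using haa') (by simpa using hb) hw hindex

/-- Modulo commutators every element is a product of one element of `A` and one of `B`. In part (2)
this excludes two factors of order 2. -/
theorem finite_abelianization_coprod [Finite A] [Finite B] :
    Finite (Abelianization (Coprod A B)) := by
  refine Finite.of_surjective (fun p : A × B =>
    (Abelianization.of (Coprod.inl p.1 * Coprod.inr p.2) : Abelianization (Coprod A B)))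
    fun q => ?_
  obtain ⟨g, rfl⟩ := QuotientGroup.mk_surjective q
  induction g using Coprod.induction_on with
  | inl a => exact ⟨(a, 1), by simp; rfl⟩
  | inr b => exact ⟨(1, b), by simp; rfl⟩
  | mul x y hx hy =>
    obtain ⟨⟨a, b⟩, h⟩ := hx
    obtain ⟨⟨a', b'⟩, h'⟩ := hy
    refine ⟨(a * a', b * b'), ?_⟩
    rw [QuotientGroup.mk_mul, ← h, ← h']
    simp only [map_mul]
    exact mul_mul_mul_comm _ _ _ _

theorem IsProper.ne_one {w : Word} (hw : IsProper.{uG, uH} w) : w ≠ 1 := by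
  rintro rfl
  obtain ⟨⟨G, _, hG⟩, -⟩ := hw
  refine hG ?_
  simp [values]

theorem not_isRational_values_of_isFreeGroup {F : Type*} [Group F] [IsFreeGroup F] {w : Word}
    (hF : ∃ a b : F, a * b ≠ b * a) (hw : w ≠ 1) (hcomm : IsCommutatorWord w) :
    ¬ IsRational (values w F) := by
  let e : F ≃* FreeGroup (IsFreeGroup.Generators F) := IsFreeGroup.toFreeGroup F
  -- With at most one generator the free group is cyclic, hence commutative.
  have hnt : Nontrivial (IsFreeGroup.Generators F) := by
    by_contra hsub
    rw [not_nontrivial_iff_subsingleton] at hsub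
    obtain ⟨a, b, hab⟩ := hF
    have hcyc : ∀ i : IsFreeGroup.Generators F, ∀ g : FreeGroup (IsFreeGroup.Generators F),
        g ∈ Subgroup.zpowers (FreeGroup.of i) := by
      intro i g
      induction g using FreeGroup.induction_on with
      | C1 => exact one_mem _
      | of j => exact Subsingleton.elim i j ▸ Subgroup.mem_zpowers _
      | inv_of j h => exact inv_mem h
      | mul x y hx hy => exact mul_mem hx hy
    refine hab (e.injective ?_)
    rw [map_mul, map_mul]
    cases isEmpty_or_nonempty (IsFreeGroup.Generators F) with
    | inl h => exact Subsingleton.elim _ _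
    | inr h =>
      obtain ⟨i⟩ := h
      obtain ⟨m, hm⟩ := hcyc i (e a)
      obtain ⟨n, hn⟩ := hcyc i (e b)
      simp only at hm hn
      rw [← hm, ← hn, zpow_mul_comm]
  obtain ⟨i, j, hij⟩ := exists_pair_ne (IsFreeGroup.Generators F)
  let x : FreeGroup Unit := FreeGroup.of ()
  let deg : FreeGroup Unit →* Multiplicative ℤ := FreeGroup.lift fun _ => Multiplicative.ofAdd 1
  have hx : x ≠ 1 := FreeGroup.of_ne_one _
  refine not_isRational_values (e.trans freeGroupEquivCoprodI) hij (a := x) (a' := x * x) (b := x)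
    hx (fun h => ?_) (fun h => hx (left_eq_mul.1 h)) hx hw ?_
  · have := congrArg (fun g => (deg g).toAdd) h
    simp [x, deg] at this
  -- The total exponent sum maps `F` onto the integers.
  · refine hcomm.not_finiteIndex (H := Multiplicative ℤ) ((FreeGroup.lift fun _ =>
      Multiplicative.ofAdd (1 : ℤ)).comp e.toMonoidHom) fun n => ?_
    refine ⟨e.symm (FreeGroup.of i ^ n.toAdd), ?_⟩
    simp [← ofAdd_zsmul]

end Coprod

end Verbal

theorem lemma5p1 :
    (∀ (A : Type uA) (B : Type uB) [Group A] [Group B] [Nontrivial A] [Nontrivial B]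
        (w : Verbal.Word),
      ¬ (Nat.card A = 2 ∧ Nat.card B = 2) →
      Verbal.IsProper.{uG, uH} w →
      ¬ (Verbal.verbalSubgroup w (Monoid.Coprod A B)).FiniteIndex →
      ¬ Verbal.IsRational (Verbal.values w (Monoid.Coprod A B))) ∧
    (∀ (A : Type uA) (B : Type uB) [Group A] [Group B] [Nontrivial A] [Nontrivial B]
        (w : Verbal.Word),
      Infinite (Abelianization (Monoid.Coprod A B)) →
      w ≠ 1 → Verbal.IsCommutatorWord w →
      ¬ Verbal.IsRational (Verbal.values w (Monoid.Coprod A B))) ∧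
    (∀ (F : Type uF) [Group F] [IsFreeGroup F] (w : Verbal.Word),
      (∃ a b : F, a * b ≠ b * a) →
      w ≠ 1 → Verbal.IsCommutatorWord w →
      ¬ Verbal.IsRational (Verbal.values w F)) := by

  refine ⟨fun A B _ _ _ _ w hcard hw hindex =>
      Verbal.not_isRational_values_coprod hcard hw.ne_one hindex,
    fun A B _ _ _ _ w hinf hw hcomm => ?_,
    fun F _ _ w hF hw hcomm => Verbal.not_isRational_values_of_isFreeGroup hF hw hcomm⟩
  refine Verbal.not_isRational_values_coprod (fun h => ?_) hw
    (hcomm.not_finiteIndex Abelianization.of QuotientGroup.mk_surjective)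
  -- `Nat.card` is `0` on infinite types, so the value 2 forces finiteness.
  have : Finite A := Nat.finite_of_card_ne_zero (by omega)
  have : Finite B := Nat.finite_of_card_ne_zero (by omega)
  have := Verbal.finite_abelianization_coprod (A := A) (B := B)
  exact not_finite (Abelianization (Monoid.Coprod A B))
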